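/- Let $ABC$ be a non-degenerate triangle in the Euclidean plane with orthocenter $H$. Let $\omega_A$ be a circle (of positive radius) that is tangent to the sides $AB$ and $AC$ (that is, it touches the line $AB$ at a point of the closed segment $AB$, and the line $AC$ at a point of the closed segment $AC$) and is externally tangent, at a point $A'$, to the circle $(BHC)$ through $B$, $H$, $C$. Similarly, let $\omega_B$ be a circle tangent to the sides $BC$ and $BA$ and externally tangent to the circle $(CHA)$ at $B'$, and let $\omega_C$ be a circle tangent to the sides $CA$ and $CB$ and externally tangent to the circle $(AHB)$ at $C'$. 1. The points $A'$, $B'$, $C'$, $H$ lie on one circle. 2. If a circle $\Omega$ (of positive radius) is externally tangent to $\omega_A$, $\omega_B$ and $\omega_C$, then $H$ lies on $\Omega$. -/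

import Mathlib

/-- The Euclidean plane. -/
abbrev Plane : Type := EuclideanSpace ℝ (Fin 2)

/-- The circle `ω` is tangent to the side `XY`: it is tangent to the line `XY` at some point of the
closed segment from `X` to `Y`. -/
def IsTangentToSide (ω : EuclideanGeometry.Sphere Plane) (X Y : Plane) : Prop :=
  ∃ Q : Plane, Wbtw ℝ X Q Y ∧ ω.IsTangentAt Q (affineSpan ℝ {X, Y})

/-- `ω` is a (nondegenerate) circle tangent to the sides `XY` and `XZ` and externally tangent at
`T` to the circle through `Y`, `H`, `Z`. -/
def IsSideTangentCircleAt (ω : EuclideanGeometry.Sphere Plane) (T X Y Z H : Plane) : Prop :=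
  0 < ω.radius ∧ IsTangentToSide ω X Y ∧ IsTangentToSide ω X Z ∧
    ∃ κ : EuclideanGeometry.Sphere Plane,
      Y ∈ κ ∧ H ∈ κ ∧ Z ∈ κ ∧ ω.IsExtTangentAt κ T

/-! Take the incenter `I` as origin. The inner products of the vectors `u`, `v`, `w`, `o` to the
vertices and the circumcenter are polynomials in the tangent lengths `x`, `y`, `z`, the inradius `r`
and the circumradius `R` (`exists_isCenteredFrame`), and `H = I + h` with `h = u + v + w - 2o`.

The circle (BHC) has center `H + (o - u)` and radius `R`, while `ω_A` is the image of the incircle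
under a homothety at `A` with ratio `k`. Their tangency is a quadratic in `k`, and tangency within
the sides leaves only `k = 1 - r²/x²` (`isMixtilinearData`). Since `k > 0`, angle `A` is acute;
likewise for `B` and `C`.

For claim 1, the center `H + q` of the required circle is a positive barycentric combination of the
centers of (BHC), (CHA), (AHB), with weights `touchWeight` (`dist_touch_eq`).

For claim 2, the circle with center `2I - O` and radius `R - 2r` (possibly a point) passes through
`H` and satisfies the three tangency equations. Comparing `Ω` with it gives a system linear in its
center, its radius and the power of `H` (`tangency_eq`). Its solution is a one-parameter family, and
the triangle inequality excludes every nonzero power (`norm_eq_of_tangent`). -/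

theorem plane_inner (p q : Plane) : inner ℝ p q = p 0 * q 0 + p 1 * q 1 := by
  simp [PiLp.inner_apply, Fin.sum_univ_two, mul_comm]

theorem plane_norm_sq (p : Plane) : ‖p‖ ^ 2 = p 0 * p 0 + p 1 * p 1 := by
  rw [← real_inner_self_eq_norm_sq, plane_inner]

theorem plane_dist_sq (p q : Plane) :
    dist p q ^ 2 = (p 0 - q 0) * (p 0 - q 0) + (p 1 - q 1) * (p 1 - q 1) := by
  rw [dist_eq_norm, plane_norm_sq]; simp

/-- A vector orthogonal to two independent vectors of the plane vanishes. -/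
theorem plane_eq_zero_of_inner {d p q : Plane} (hp : inner ℝ d p = 0) (hq : inner ℝ d q = 0)
    (hpq : inner ℝ p p * inner ℝ q q - inner ℝ p q ^ 2 ≠ 0) : d = 0 := by
  simp only [plane_inner] at *
  have hc : p 0 * q 1 - p 1 * q 0 ≠ 0 := by
    intro h
    apply hpq
    linear_combination (p 0 * q 1 - p 1 * q 0) * h
  ext i
  fin_cases i
  · apply mul_left_cancel₀ hc
    simp only [Fin.zero_eta, PiLp.zero_apply]
    linear_combination q 1 * hp - p 1 * hq
  · apply mul_left_cancel₀ hc
    simp only [Fin.mk_one, PiLp.zero_apply]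
    linear_combination p 0 * hq - q 0 * hp

/-! ### Inner products of a triangle seen from its incenter. -/

/-- The vectors `u`, `v`, `w` from the incenter to the vertices and `o` to the circumcenter of a
triangle with tangent lengths `x`, `y`, `z`, inradius `r` and circumradius `R`. -/
structure IsCenteredFrame (u v w o : Plane) (x y z r R : ℝ) : Prop where
  x_pos : 0 < x
  y_pos : 0 < y
  z_pos : 0 < z
  r_pos : 0 < r
  R_pos : 0 < R
  r_sq : r ^ 2 * (x + y + z) = x * y * z
  R_eq : 4 * (R * r) * (x + y + z) = (x + y) * (y + z) * (z + x)
  uu : inner ℝ u u = r ^ 2 + x ^ 2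
  vv : inner ℝ v v = r ^ 2 + y ^ 2
  ww : inner ℝ w w = r ^ 2 + z ^ 2
  uv : inner ℝ u v = r ^ 2 - x * y
  vw : inner ℝ v w = r ^ 2 - y * z
  wu : inner ℝ w u = r ^ 2 - z * x
  oo : inner ℝ o o = R ^ 2 - 2 * (R * r)
  ou : inner ℝ o u = (r ^ 2 + x ^ 2 - 2 * (R * r)) / 2
  ov : inner ℝ o v = (r ^ 2 + y ^ 2 - 2 * (R * r)) / 2
  ow : inner ℝ o w = (r ^ 2 + z ^ 2 - 2 * (R * r)) / 2

namespace IsCenteredFrame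

variable {u v w o : Plane} {x y z r R : ℝ}

theorem rotate (F : IsCenteredFrame u v w o x y z r R) : IsCenteredFrame v w u o y z x r R where
  x_pos := F.y_pos
  y_pos := F.z_pos
  z_pos := F.x_pos
  r_pos := F.r_pos
  R_pos := F.R_pos
  r_sq := by linear_combination F.r_sq
  R_eq := by linear_combination F.R_eq
  uu := F.vv
  vv := F.ww
  ww := F.uu
  uv := F.vw
  vw := F.wu
  wu := F.uv
  oo := F.oo
  ou := F.ov
  ov := F.ow
  ow := F.ou

theorem swap (F : IsCenteredFrame u v w o x y z r R) : IsCenteredFrame u w v o x z y r R where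
  x_pos := F.x_pos
  y_pos := F.z_pos
  z_pos := F.y_pos
  r_pos := F.r_pos
  R_pos := F.R_pos
  r_sq := by linear_combination F.r_sq
  R_eq := by linear_combination F.R_eq
  uu := F.uu
  vv := F.ww
  ww := F.vv
  uv := by rw [real_inner_comm, F.wu]; ring
  vw := by rw [real_inner_comm, F.vw]; ring
  wu := by rw [real_inner_comm, F.uv]; ring
  oo := F.oo
  ou := F.ou
  ov := F.ow
  ow := F.ov

/-- By Heron's formula the two edge vectors have Gram determinant `4xyz(x + y + z) > 0`. -/
theorem eq_zero_of_inner (F : IsCenteredFrame u v w o x y z r R) {d : Plane}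
    (hv : inner ℝ d (v - u) = 0) (hw : inner ℝ d (w - u) = 0) : d = 0 := by
  apply plane_eq_zero_of_inner hv hw
  have h1 : inner ℝ (v - u) (v - u) = (x + y) ^ 2 := by
    rw [inner_sub_left, inner_sub_right, inner_sub_right, real_inner_comm u v, F.vv, F.uv, F.uu]
    ring
  have h2 : inner ℝ (w - u) (w - u) = (x + z) ^ 2 := by
    rw [inner_sub_left, inner_sub_right, inner_sub_right, real_inner_comm w u, F.ww, F.wu, F.uu]
    ring
  have h3 : inner ℝ (v - u) (w - u) = x * (x + y + z) - y * z := by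
    rw [inner_sub_left, inner_sub_right, inner_sub_right, real_inner_comm w u, real_inner_comm u v,
      F.vw, F.wu, F.uu, F.uv]
    ring
  rw [h1, h2, h3]
  have := F.x_pos
  have := F.y_pos
  have := F.z_pos
  have : 0 < 4 * (x * y * z) * (x + y + z) := by positivity
  intro h
  nlinarith

end IsCenteredFrame

/-- The squared distance from the incenter to a vertex, from the Gram matrix of the vectors to the
vertices. -/
theorem incenter_gram {x y z U V W p q t : ℝ} (hx : 0 < x) (hy : 0 < y) (hz : 0 < z)
    (h1 : (y + z) * U + (z + x) * p + (x + y) * t = 0)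
    (h2 : (y + z) * p + (z + x) * V + (x + y) * q = 0)
    (h3 : (y + z) * t + (z + x) * q + (x + y) * W = 0)
    (hc : U + V - 2 * p = (x + y) ^ 2) (ha : V + W - 2 * q = (y + z) ^ 2)
    (hb : W + U - 2 * t = (z + x) ^ 2) :
    U * (x + y + z) = x * (x + y) * (x + z) ∧
      (y + z) * U + (z + x) * V + (x + y) * W = (x + y) * (y + z) * (z + x) := by
  have hs : 4 * (x + y + z) ≠ 0 := by positivity
  have e1 : 2 * (x + y + z) * U + ((y + z) * U + (z + x) * V + (x + y) * W) =
      (z + x) * (x + y) * (2 * x + y + z) := by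
    linear_combination 2 * h1 + (z + x) * hc + (x + y) * hb
  have e2 : 2 * (x + y + z) * V + ((y + z) * U + (z + x) * V + (x + y) * W) =
      (x + y) * (y + z) * (2 * y + z + x) := by
    linear_combination 2 * h2 + (x + y) * ha + (y + z) * hc
  have e3 : 2 * (x + y + z) * W + ((y + z) * U + (z + x) * V + (x + y) * W) =
      (y + z) * (z + x) * (2 * z + x + y) := by
    linear_combination 2 * h3 + (y + z) * hb + (z + x) * ha
  have hT : (y + z) * U + (z + x) * V + (x + y) * W = (x + y) * (y + z) * (z + x) := by
    apply mul_left_cancel₀ hs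
    linear_combination (y + z) * e1 + (z + x) * e2 + (x + y) * e3
  exact ⟨by linear_combination (e1 - hT) / 2, hT⟩

/-- Every triangle has a centered frame. -/
theorem exists_isCenteredFrame (A B C : Plane) (hABC : AffineIndependent ℝ ![A, B, C]) (H : Plane)
    (hH : H = Affine.Triangle.orthocenter (⟨![A, B, C], hABC⟩ : Affine.Triangle ℝ Plane)) :
    ∃ (I u v w o : Plane) (x y z r R : ℝ), IsCenteredFrame u v w o x y z r R ∧
      A = I + u ∧ B = I + v ∧ C = I + w ∧ H = I + (u + v + w - (2 : ℝ) • o) := by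
  set t : Affine.Triangle ℝ Plane := ⟨![A, B, C], hABC⟩ with ht
  have hnc : ¬ Collinear ℝ {A, B, C} := affineIndependent_iff_not_collinear_set.1 hABC
  obtain ⟨a, ha⟩ : ∃ a, a = dist B C := ⟨_, rfl⟩
  obtain ⟨b, hb⟩ : ∃ b, b = dist C A := ⟨_, rfl⟩
  obtain ⟨c, hc⟩ : ∃ c, c = dist A B := ⟨_, rfl⟩
  obtain ⟨R, hR⟩ : ∃ R, R = t.circumradius := ⟨_, rfl⟩
  obtain ⟨O, hO⟩ : ∃ O, O = t.circumcenter := ⟨_, rfl⟩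
  have hx : 0 < (b + c - a) / 2 := by
    have h1 : dist B C ≤ dist B A + dist A C := dist_triangle _ _ _
    have h2 : dist B A + dist A C ≠ dist B C := fun h => hnc <| by
      have := (dist_add_dist_eq_iff.1 h).collinear
      rwa [Set.insert_comm] at this
    rw [ha, hb, hc, dist_comm C A, dist_comm A B]
    have := lt_of_le_of_ne h1 h2.symm
    linarith
  have hy : 0 < (c + a - b) / 2 := by
    have h1 : dist A C ≤ dist A B + dist B C := dist_triangle _ _ _
    have h2 : dist A B + dist B C ≠ dist A C := fun h => hnc
      (dist_add_dist_eq_iff.1 h).collinear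
    rw [ha, hb, hc, dist_comm C A]
    have := lt_of_le_of_ne h1 h2.symm
    linarith
  have hz : 0 < (a + b - c) / 2 := by
    have h1 : dist A B ≤ dist A C + dist C B := dist_triangle _ _ _
    have h2 : dist A C + dist C B ≠ dist A B := fun h => hnc <| by
      have := (dist_add_dist_eq_iff.1 h).collinear
      rwa [Set.pair_comm C B] at this
    rw [ha, hb, hc, dist_comm C A, dist_comm B C]
    have := lt_of_le_of_ne h1 h2.symm
    linarith
  obtain ⟨x, hx'⟩ : ∃ x, x = (b + c - a) / 2 := ⟨_, rfl⟩
  obtain ⟨y, hy'⟩ : ∃ y, y = (c + a - b) / 2 := ⟨_, rfl⟩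
  obtain ⟨z, hz'⟩ : ∃ z, z = (a + b - c) / 2 := ⟨_, rfl⟩
  rw [← hx'] at hx
  rw [← hy'] at hy
  rw [← hz'] at hz
  have haq : dist B C ^ 2 = (y + z) ^ 2 := by rw [← ha, hy', hz']; ring
  have hbq : dist C A ^ 2 = (z + x) ^ 2 := by rw [← hb, hx', hz']; ring
  have hcq : dist A B ^ 2 = (x + y) ^ 2 := by rw [← hc, hx', hy']; ring
  have hOA : dist A O ^ 2 = R ^ 2 := by
    rw [hO, hR]; congr 1; exact t.dist_circumcenter_eq_circumradius 0
  have hOB : dist B O ^ 2 = R ^ 2 := by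
    rw [hO, hR]; congr 1; exact t.dist_circumcenter_eq_circumradius 1
  have hOC : dist C O ^ 2 = R ^ 2 := by
    rw [hO, hR]; congr 1; exact t.dist_circumcenter_eq_circumradius 2
  have hRpos : 0 < R := hR ▸ t.circumradius_pos
  have hHO : H = A + B + C - (2 : ℝ) • O := by
    have := t.orthocenter_vsub_circumcenter_eq_sum_vsub
    rw [← hH, ← hO, Fin.sum_univ_three] at this
    simp only [ht, vsub_eq_sub, Matrix.cons_val] at this
    rw [sub_eq_iff_eq_add.1 this, two_smul]
    abel
  clear_value t
  clear hx' hy' hz' ha hb hc hO hR hH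
  have hs : 0 < x + y + z := by positivity
  obtain ⟨I, hI⟩ : ∃ I, I = (1 / (2 * (x + y + z))) • ((y + z) • A + (z + x) • B + (x + y) • C) :=
    ⟨_, rfl⟩
  -- `e` will turn out to be `r²`, and `q` below to be `2Rr`.
  obtain ⟨e, he⟩ : ∃ e, e = x * y * z / (x + y + z) := ⟨_, rfl⟩
  have hes : e * (x + y + z) = x * y * z := by rw [he]; field_simp
  have hepos : 0 < e := by rw [he]; positivity
  obtain ⟨q, hq⟩ : ∃ q, q = (x + y) * (y + z) * (z + x) / (2 * (x + y + z)) := ⟨_, rfl⟩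
  have hqs : 2 * q * (x + y + z) = (x + y) * (y + z) * (z + x) := by rw [hq]; field_simp
  have hqpos : 0 < q := by rw [hq]; positivity
  have hI0 : 2 * (x + y + z) * I 0 = (y + z) * A 0 + (z + x) * B 0 + (x + y) * C 0 := by
    rw [hI]; simp; field_simp
  have hI1 : 2 * (x + y + z) * I 1 = (y + z) * A 1 + (z + x) * B 1 + (x + y) * C 1 := by
    rw [hI]; simp; field_simp
  clear hI he hq
  simp only [plane_dist_sq] at haq hbq hcq hOA hOB hOC
  obtain ⟨u, rfl⟩ : ∃ u, A = I + u := ⟨A - I, by abel⟩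
  obtain ⟨v, rfl⟩ : ∃ v, B = I + v := ⟨B - I, by abel⟩
  obtain ⟨w, rfl⟩ : ∃ w, C = I + w := ⟨C - I, by abel⟩
  obtain ⟨o, rfl⟩ : ∃ o, O = I + o := ⟨O - I, by abel⟩
  simp only [PiLp.add_apply] at haq hbq hcq hOA hOB hOC hI0 hI1
  have b0 : (y + z) * u 0 + (z + x) * v 0 + (x + y) * w 0 = 0 := by linear_combination -hI0
  have b1 : (y + z) * u 1 + (z + x) * v 1 + (x + y) * w 1 = 0 := by linear_combination -hI1
  have g1 := incenter_gram (U := inner ℝ u u) (V := inner ℝ v v) (W := inner ℝ w w)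
    (p := inner ℝ u v) (q := inner ℝ v w) (t := inner ℝ w u) hx hy hz
    (by simp only [plane_inner]; linear_combination u 0 * b0 + u 1 * b1)
    (by simp only [plane_inner]; linear_combination v 0 * b0 + v 1 * b1)
    (by simp only [plane_inner]; linear_combination w 0 * b0 + w 1 * b1)
    (by simp only [plane_inner]; linear_combination hcq)
    (by simp only [plane_inner]; linear_combination haq)
    (by simp only [plane_inner]; linear_combination hbq)
  have g2 := incenter_gram (U := inner ℝ v v) (V := inner ℝ w w) (W := inner ℝ u u)
    (p := inner ℝ v w) (q := inner ℝ w u) (t := inner ℝ u v) hy hz hx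
    (by simp only [plane_inner]; linear_combination v 0 * b0 + v 1 * b1)
    (by simp only [plane_inner]; linear_combination w 0 * b0 + w 1 * b1)
    (by simp only [plane_inner]; linear_combination u 0 * b0 + u 1 * b1)
    (by simp only [plane_inner]; linear_combination haq)
    (by simp only [plane_inner]; linear_combination hbq)
    (by simp only [plane_inner]; linear_combination hcq)
  have g3 := incenter_gram (U := inner ℝ w w) (V := inner ℝ u u) (W := inner ℝ v v)
    (p := inner ℝ w u) (q := inner ℝ u v) (t := inner ℝ v w) hz hx hy
    (by simp only [plane_inner]; linear_combination w 0 * b0 + w 1 * b1)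
    (by simp only [plane_inner]; linear_combination u 0 * b0 + u 1 * b1)
    (by simp only [plane_inner]; linear_combination v 0 * b0 + v 1 * b1)
    (by simp only [plane_inner]; linear_combination hbq)
    (by simp only [plane_inner]; linear_combination hcq)
    (by simp only [plane_inner]; linear_combination haq)
  have uu : inner ℝ u u = e + x ^ 2 := by
    apply mul_right_cancel₀ hs.ne'
    linear_combination g1.1 - hes
  have vv : inner ℝ v v = e + y ^ 2 := by
    apply mul_right_cancel₀ hs.ne'
    linear_combination g2.1 - hes
  have ww : inner ℝ w w = e + z ^ 2 := by
    apply mul_right_cancel₀ hs.ne'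
    linear_combination g3.1 - hes
  have uv : inner ℝ u v = e - x * y := by
    simp only [plane_inner] at *
    linear_combination (uu + vv - hcq) / 2
  have vw : inner ℝ v w = e - y * z := by
    simp only [plane_inner] at *
    linear_combination (vv + ww - haq) / 2
  have wu : inner ℝ w u = e - z * x := by
    simp only [plane_inner] at *
    linear_combination (ww + uu - hbq) / 2
  have hT := g1.2
  clear g1 g2 g3
  have oo : inner ℝ o o = R ^ 2 - q := by
    apply mul_left_cancel₀ (mul_pos two_pos hs).ne'
    simp only [plane_inner] at *
    linear_combination (y + z) * hOA + (z + x) * hOB + (x + y) * hOC - hT + hqs +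
      2 * o 0 * b0 + 2 * o 1 * b1
  have ou : inner ℝ o u = (e + x ^ 2 - q) / 2 := by
    simp only [plane_inner] at *
    linear_combination (oo + uu - hOA) / 2
  have ov : inner ℝ o v = (e + y ^ 2 - q) / 2 := by
    simp only [plane_inner] at *
    linear_combination (oo + vv - hOB) / 2
  have ow : inner ℝ o w = (e + z ^ 2 - q) / 2 := by
    simp only [plane_inner] at *
    linear_combination (oo + ww - hOC) / 2
  -- The Gram determinant of three vectors in a plane vanishes; this ties the circumradius to `q`.
  have hdet : inner ℝ o o * (inner ℝ u u * inner ℝ v v - inner ℝ u v ^ 2) =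
      inner ℝ o u ^ 2 * inner ℝ v v - 2 * inner ℝ o u * inner ℝ o v * inner ℝ u v +
        inner ℝ o v ^ 2 * inner ℝ u u := by
    simp only [plane_inner]; ring
  rw [oo, uu, vv, uv, ou, ov] at hdet
  have hq2 : (e + x ^ 2) * (e + y ^ 2) = 2 * q * (x * y - e) := by
    apply mul_right_cancel₀ (pow_pos hs 2).ne'
    have k1 : (e + x ^ 2) * (x + y + z) = x * (x + y) * (x + z) := by linear_combination hes
    have k2 : (e + y ^ 2) * (x + y + z) = y * (x + y) * (y + z) := by linear_combination hes
    have k3 : (x * y - e) * (x + y + z) = x * y * (x + y) := by linear_combination -hes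
    calc _ = ((e + x ^ 2) * (x + y + z)) * ((e + y ^ 2) * (x + y + z)) := by ring
      _ = (2 * q * (x + y + z)) * ((x * y - e) * (x + y + z)) := by rw [k1, k2, k3, hqs]; ring
      _ = _ := by ring
  have hqR : 4 * e * R ^ 2 = q ^ 2 := by
    apply mul_right_cancel₀ (pow_pos (add_pos hx hy) 2).ne'
    linear_combination 4 * hdet + (x + y) ^ 2 * hq2
  have hr2 : √e ^ 2 = e := Real.sq_sqrt hepos.le
  have hrpos : 0 < √e := Real.sqrt_pos.2 hepos
  have hqr : q = 2 * (R * √e) := by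
    rw [← sq_eq_sq₀ hqpos.le (by positivity), ← hqR]
    linear_combination -4 * R ^ 2 * hr2
  refine ⟨I, u, v, w, o, x, y, z, √e, R, ⟨hx, hy, hz, hrpos, hRpos, ?_, ?_, ?_, ?_, ?_, ?_, ?_, ?_,
    ?_, ?_, ?_, ?_⟩, rfl, rfl, rfl, ?_⟩
  · rw [hr2, hes]
  · rw [← hqs, hqr]; ring
  all_goals try rw [hr2]
  all_goals try rw [← hqr]
  all_goals try assumption
  rw [hHO, smul_add, two_smul]
  abel

/-! ### Circles tangent to two sides. -/

/-- A point of a circle externally tangent to another one divides the segment of centers in the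
ratio of the radii. -/
theorem EuclideanGeometry.Sphere.IsExtTangentAt.smul_sub_eq {s₁ s₂ : EuclideanGeometry.Sphere Plane}
    {T : Plane} (h : s₁.IsExtTangentAt s₂ T) (X : Plane) :
    (s₁.radius + s₂.radius) • (T - X) =
      s₂.radius • (s₁.center - X) + s₁.radius • (s₂.center - X) := by
  obtain ⟨θ, ⟨h0, -⟩, hθ⟩ := h.wbtw
  have hd := h.isExtTangent.dist_center
  have hT : dist T s₁.center = s₁.radius := h.mem_left
  rw [← hθ, dist_lineMap_left, hd, Real.norm_of_nonneg h0] at hT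
  have hθ' : θ * (s₁.radius + s₂.radius) = s₁.radius := hT
  rw [← hθ, AffineMap.lineMap_apply]
  simp only [vsub_eq_sub, vadd_eq_add]
  ext i
  simp only [PiLp.smul_apply, PiLp.sub_apply, PiLp.add_apply, smul_eq_mul]
  linear_combination (s₂.center i - s₁.center i) * hθ'

/-- The point of tangency of a circle with a side. -/
theorem IsTangentToSide.exists_smul {ω : EuclideanGeometry.Sphere Plane} {X Y : Plane}
    (h : IsTangentToSide ω X Y) : ∃ θ : ℝ, 0 ≤ θ ∧ θ ≤ 1 ∧
      dist (X + θ • (Y - X)) ω.center = ω.radius ∧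
      inner ℝ (Y - X) (X + θ • (Y - X) - ω.center) = 0 := by
  obtain ⟨Q, ⟨θ, ⟨h0, h1⟩, rfl⟩, hQ⟩ := h
  have e : AffineMap.lineMap X Y θ = X + θ • (Y - X) := by
    rw [AffineMap.lineMap_apply]; simp [add_comm]
  rw [e] at hQ
  refine ⟨θ, h0, h1, hQ.mem_sphere, ?_⟩
  have hX := hQ.inner_left_eq_zero_of_mem (left_mem_affineSpan_pair ℝ X Y)
  have hY := hQ.inner_left_eq_zero_of_mem (right_mem_affineSpan_pair ℝ X Y)
  simp only [vsub_eq_sub] at hX hY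
  have hXY := inner_sub_left (𝕜 := ℝ) (Y - (X + θ • (Y - X))) (X - (X + θ • (Y - X)))
    (X + θ • (Y - X) - ω.center)
  rwa [hX, hY, sub_zero, sub_sub_sub_cancel_right] at hXY

namespace IsCenteredFrame

variable {u v w o I : Plane} {x y z r R : ℝ}

/-- A circle tangent to two sides is homothetic to the incircle. -/
theorem exists_center_eq (F : IsCenteredFrame u v w o x y z r R)
    {ω : EuclideanGeometry.Sphere Plane} (hω : 0 < ω.radius)
    (hv : IsTangentToSide ω (I + u) (I + v)) (hw : IsTangentToSide ω (I + u) (I + w)) :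
    ∃ k : ℝ, 0 < k ∧ k * x ≤ x + y ∧ ω.center = I + (1 - k) • u ∧ ω.radius = k * r := by
  obtain ⟨θ, h0, h1, hd, hi⟩ := hv.exists_smul
  obtain ⟨θ', h0', h1', hd', hi'⟩ := hw.exists_smul
  have hx := F.x_pos
  have hy := F.y_pos
  have hz := F.z_pos
  have hr := F.r_pos
  have uu := F.uu
  have vv := F.vv
  have ww := F.ww
  have uv := F.uv
  have wu := F.wu
  obtain ⟨p, hp⟩ : ∃ p, ω.center = I + p := ⟨ω.center - I, by abel⟩
  have hd2 := congrArg (· ^ 2) hd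
  have hd2' := congrArg (· ^ 2) hd'
  simp only [plane_dist_sq] at hd2 hd2'
  rw [hp] at hd2 hd2' hi hi'
  simp only [plane_inner, PiLp.add_apply, PiLp.sub_apply, PiLp.smul_apply, smul_eq_mul] at *
  have e1 : (u 0 - p 0) * (u 0 - p 0) + (u 1 - p 1) * (u 1 - p 1) =
      ω.radius ^ 2 + (θ * (x + y)) ^ 2 := by
    linear_combination hd2 - 2 * θ * hi + θ ^ 2 * (uu + vv - 2 * uv)
  have e2 : (u 0 - p 0) * (u 0 - p 0) + (u 1 - p 1) * (u 1 - p 1) =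
      ω.radius ^ 2 + (θ' * (z + x)) ^ 2 := by
    linear_combination hd2' - 2 * θ' * hi' + θ' ^ 2 * (uu + ww - 2 * wu)
  -- The two tangent lengths from the common vertex agree; `k` is their ratio to the incircle's
  -- tangent length `x`.
  have ht : θ * (x + y) = θ' * (z + x) := by
    rw [← sq_eq_sq₀ (by positivity) (by positivity)]
    linear_combination e2 - e1
  obtain ⟨k, hk⟩ : ∃ k, k = θ * (x + y) / x := ⟨_, rfl⟩
  have hkx : k * x = θ * (x + y) := by rw [hk]; field_simp
  have hk0 : 0 ≤ k := by rw [hk]; positivity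
  have hpk : p - (1 - k) • u = 0 := by
    apply F.eq_zero_of_inner
    · simp only [plane_inner, PiLp.sub_apply, PiLp.smul_apply, smul_eq_mul]
      linear_combination -hi + θ * (uu + vv - 2 * uv) + k * (uv - uu) - (x + y) * hkx
    · simp only [plane_inner, PiLp.sub_apply, PiLp.smul_apply, smul_eq_mul]
      linear_combination -hi' + θ' * (uu + ww - 2 * wu) + k * (wu - uu) - (x + z) * (hkx + ht)
  have hpk' : p = (1 - k) • u := sub_eq_zero.1 hpk
  have hrad : ω.radius = k * r := by
    rw [← sq_eq_sq₀ hω.le (by positivity)]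
    rw [hpk'] at e1
    simp only [PiLp.smul_apply, smul_eq_mul] at e1
    linear_combination k ^ 2 * uu - e1 + (k * x + θ * (x + y)) * hkx
  refine ⟨k, ?_, ?_, by rw [hp, hpk'], hrad⟩
  · rw [hrad] at hω
    exact pos_of_mul_pos_left hω hr.le
  · rw [hkx]
    exact mul_le_of_le_one_left (by positivity) h1

/-! ### The orthocenter and the circles (BHC), (CHA), (AHB). -/

/-- The barycentric coordinates of the orthocenter. -/
theorem orthocenter_eq (F : IsCenteredFrame u v w o x y z r R) :
    (4 * (x * y * z) * (x + y + z)) • (u + v + w - (2 : ℝ) • o) =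
      ((y * (x + y + z) - z * x) * (z * (x + y + z) - x * y)) • u +
      ((z * (x + y + z) - x * y) * (x * (x + y + z) - y * z)) • v +
      ((x * (x + y + z) - y * z) * (y * (x + y + z) - z * x)) • w := by
  rw [← sub_eq_zero]
  have hr := F.r_sq
  have uu := F.uu
  have vv := F.vv
  have ww := F.ww
  have uv := F.uv
  have vw := F.vw
  have wu := F.wu
  have ou := F.ou
  have ov := F.ov
  have ow := F.ow
  apply F.eq_zero_of_inner
  · simp only [plane_inner, PiLp.add_apply, PiLp.sub_apply, PiLp.smul_apply, smul_eq_mul] at *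
    linear_combination (4 * (x * y * z) * (x + y + z)) * (uv + vv + vw - 2 * ov - uu - uv - wu + 2 * ou)
      - ((y * (x + y + z) - z * x) * (z * (x + y + z) - x * y)) * (uv - uu)
      - ((z * (x + y + z) - x * y) * (x * (x + y + z) - y * z)) * (vv - uv)
      - ((x * (x + y + z) - y * z) * (y * (x + y + z) - z * x)) * (vw - wu)
  · simp only [plane_inner, PiLp.add_apply, PiLp.sub_apply, PiLp.smul_apply, smul_eq_mul] at *
    linear_combination (4 * (x * y * z) * (x + y + z)) * (wu + vw + ww - 2 * ow - uu - uv - wu + 2 * ou)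
      - ((y * (x + y + z) - z * x) * (z * (x + y + z) - x * y)) * (wu - uu)
      - ((z * (x + y + z) - x * y) * (x * (x + y + z) - y * z)) * (vw - uv)
      - ((x * (x + y + z) - y * z) * (y * (x + y + z) - z * x)) * (ww - wu)

/-- The circle through two vertices and the orthocenter is a translate of the circumcircle. -/
theorem center_eq_of_mem (F : IsCenteredFrame u v w o x y z r R)
    (hy : y * (x + y + z) - z * x ≠ 0) (hz : z * (x + y + z) - x * y ≠ 0)
    {κ : EuclideanGeometry.Sphere Plane} (hv : I + v ∈ κ)
    (hh : I + (u + v + w - (2 : ℝ) • o) ∈ κ) (hw : I + w ∈ κ) :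
    κ.center = I + (v + w - o) ∧ κ.radius = R := by
  have hO := F.orthocenter_eq
  have h0 := congrFun (congrArg WithLp.ofLp hO) 0
  have h1 := congrFun (congrArg WithLp.ofLp hO) 1
  obtain ⟨p, hp⟩ : ∃ p, κ.center = I + (v + w - o) + p := ⟨κ.center - (I + (v + w - o)), by abel⟩
  have hκ : 0 ≤ κ.radius := by
    rw [← show dist (I + v) κ.center = κ.radius from hv]; exact dist_nonneg
  have e1 := congrArg (· ^ 2) (show dist _ _ = _ from hv)
  have e2 := congrArg (· ^ 2) (show dist _ _ = _ from hh)
  have e3 := congrArg (· ^ 2) (show dist _ _ = _ from hw)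
  have uu := F.uu
  have vv := F.vv
  have ww := F.ww
  have ou := F.ou
  have ov := F.ov
  have ow := F.ow
  have oo := F.oo
  rw [hp] at e1 e2 e3
  simp only [plane_inner, plane_dist_sq, PiLp.add_apply, PiLp.sub_apply, PiLp.smul_apply,
    smul_eq_mul] at *
  -- The error `p` in the center is orthogonal to the chords `h - v` and `h - w`. These are
  -- independent because `hy` and `hz` exclude right angles at the two vertices.
  have f1 : p 0 * (u 0 + w 0 - 2 * o 0) + p 1 * (u 1 + w 1 - 2 * o 1) = 0 := by
    linear_combination (e1 - e2) / 2 + (uu - 2 * ou - ww + 2 * ow) / 2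
  have f2 : p 0 * (u 0 + v 0 - 2 * o 0) + p 1 * (u 1 + v 1 - 2 * o 1) = 0 := by
    linear_combination (e3 - e2) / 2 + (uu - 2 * ou - vv + 2 * ov) / 2
  have hx := F.x_pos
  have hy' := F.y_pos
  have hz' := F.z_pos
  have hS : 0 < 4 * (x * y * z) * (x + y + z) := by positivity
  have g1 : p 0 * (v 0 - w 0) + p 1 * (v 1 - w 1) = 0 := by linear_combination f2 - f1
  have g2 : p 0 * (v 0 - u 0) + p 1 * (v 1 - u 1) = 0 := by
    apply mul_left_cancel₀ (mul_ne_zero hy hz)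
    linear_combination (-(4 * (x * y * z) * (x + y + z))) * f1 + p 0 * h0 + p 1 * h1
      - ((x * (x + y + z) - y * z) * (y * (x + y + z) - z * x)) * g1
  have hp0 : p = 0 := by
    apply F.eq_zero_of_inner
    · simp only [plane_inner, PiLp.sub_apply]
      exact g2
    · simp only [plane_inner, PiLp.sub_apply]
      linear_combination g2 - g1
  subst hp0
  simp only [PiLp.zero_apply] at e1
  refine ⟨by rw [hp, add_zero], ?_⟩
  rw [← sq_eq_sq₀ hκ F.R_pos.le]
  linear_combination -e1 + oo - 2 * ow + ww

/-! ### Explicit form of the three circles. -/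

/-- The data of a circle tangent to two sides and externally tangent to the circle through the two
other vertices and the orthocenter. -/
structure IsMixtilinearData (u v w o I : Plane) (x r R : ℝ)
    (ω : EuclideanGeometry.Sphere Plane) (T : Plane) : Prop where
  r_lt : r < x
  center_eq : ω.center = I + (r ^ 2 / x ^ 2) • u
  radius_eq : ω.radius = (1 - r ^ 2 / x ^ 2) * r
  touch_eq : (ω.radius + R) • (T - (I + (u + v + w - (2 : ℝ) • o))) =
    R • (ω.center - (I + (u + v + w - (2 : ℝ) • o))) + ω.radius • (o - u)
  dist_eq : dist T (I + (v + w - o)) = R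

theorem isMixtilinearData (F : IsCenteredFrame u v w o x y z r R)
    (hy : y * (x + y + z) - z * x ≠ 0) (hz : z * (x + y + z) - x * y ≠ 0)
    {ω : EuclideanGeometry.Sphere Plane} {T : Plane}
    (hω : IsSideTangentCircleAt ω T (I + u) (I + v) (I + w) (I + (u + v + w - (2 : ℝ) • o))) :
    IsMixtilinearData u v w o I x r R ω T := by
  obtain ⟨h0, hv, hw, κ, kv, kh, kw, hκ⟩ := hω
  obtain ⟨k, hk, hkx, hc, hρ⟩ := F.exists_center_eq h0 hv hw
  obtain ⟨hK, hKR⟩ := F.center_eq_of_mem hy hz kv kh kw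
  have hx := F.x_pos
  have hy' := F.y_pos
  have hz' := F.z_pos
  have hr := F.r_pos
  have hd := congrArg (· ^ 2) hκ.isExtTangent.dist_center
  have hr2 := F.r_sq
  have hquad : (k * x ^ 2 - (x ^ 2 - r ^ 2)) * (k * x - 2 * (x + y + z)) = 0 := by
    have uu := F.uu
    have vv := F.vv
    have ww := F.ww
    have uv := F.uv
    have vw := F.vw
    have wu := F.wu
    have ou := F.ou
    have ov := F.ov
    have ow := F.ow
    have oo := F.oo
    rw [hc, hK, hρ, hKR] at hd
    simp only [plane_inner, plane_dist_sq, PiLp.add_apply, PiLp.sub_apply, PiLp.smul_apply,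
      smul_eq_mul] at *
    linear_combination x * (hd - (1 - k) ^ 2 * uu - vv - ww - oo + 2 * (1 - k) * uv
      + 2 * (1 - k) * wu - 2 * vw - 2 * (1 - k) * ou + 2 * ov + 2 * ow) - 2 * hr2
  -- The other root `kx = 2(x + y + z)` exceeds the bound `kx ≤ x + y`, so its touch point would lie
  -- beyond the side.
  have hk1 : k * x ^ 2 = x ^ 2 - r ^ 2 := by
    rcases mul_eq_zero.1 hquad with h | h
    · linarith
    · linarith
  have hk2 : k = 1 - r ^ 2 / x ^ 2 := by
    field_simp
    exact hk1
  refine ⟨?_, ?_, ?_, ?_, ?_⟩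
  · have : 0 < k * x ^ 2 := by positivity
    exact lt_of_pow_lt_pow_left₀ 2 hx.le (by linarith)
  · rw [hc, hk2]; congr 2; ring
  · rw [hρ, hk2]
  · have := hκ.smul_sub_eq (I + (u + v + w - (2 : ℝ) • o))
    rw [hKR] at this
    rw [this, hK]
    congr 2
    rw [two_smul]
    abel
  · rw [← hK, ← hKR]
    exact hκ.mem_right

/-- The conclusion says that the inner product of the edges at `u` is positive; it is `r² < x²`
multiplied by `x + y + z`, with `r²(x + y + z) = xyz`. -/
theorem IsMixtilinearData.acute {ω : EuclideanGeometry.Sphere Plane} {T : Plane}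
    (F : IsCenteredFrame u v w o x y z r R) (h : IsMixtilinearData u v w o I x r R ω T) :
    0 < x * (x + y + z) - y * z := by
  have hx := F.x_pos
  have hy := F.y_pos
  have hz := F.z_pos
  have h2 : r ^ 2 < x ^ 2 := pow_lt_pow_left₀ h.r_lt F.r_pos.le two_ne_zero
  have hs : 0 < x + y + z := by positivity
  have h3 := mul_lt_mul_of_pos_right h2 hs
  rw [F.r_sq] at h3
  have : 0 < x * (x * (x + y + z) - y * z) := by linarith
  exact pos_of_mul_pos_right this hx.le

end IsCenteredFrame

/-! ### Claim 1: the touch points and `H` are concyclic. -/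

/-- The barycentric weights of the circle through the points of tangency and the orthocenter. -/
def touchWeight (x y z : ℝ) : ℝ := x * (y + z) * (x + y + 2 * z) * (x + 2 * y + z)

theorem touchWeight_pos {x y z : ℝ} (hx : 0 < x) (hy : 0 < y) (hz : 0 < z) :
    0 < touchWeight x y z := by
  unfold touchWeight; positivity

namespace IsCenteredFrame

variable {u v w o I : Plane} {x y z r R : ℝ}

theorem ratio_mul (F : IsCenteredFrame u v w o x y z r R) :
    r ^ 2 / x ^ 2 * (x * (x + y + z)) = y * z := by
  have hx := F.x_pos
  have h := F.r_sq
  field_simp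
  linear_combination h

/-- The factored right side changes sign through `y - z` when `y` and `z` are exchanged. The weights
`touchWeight` are chosen to balance the remaining factors. -/
theorem touch_inner (F : IsCenteredFrame u v w o x y z r R) {ω : EuclideanGeometry.Sphere Plane}
    {T : Plane} (h : IsMixtilinearData u v w o I x r R ω T) :
    4 * (x + y + z) ^ 2 * ((ω.radius + R) * r *
      inner ℝ (T - (I + (u + v + w - (2 : ℝ) • o))) (v - u)) =
      z * (x + y) * (x * (x + y + z) - y * z) * (y - z) * (x + 2 * y + z) := by
  have hT := h.touch_eq
  have hj := F.ratio_mul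
  rw [h.center_eq, h.radius_eq] at hT
  rw [h.radius_eq]
  generalize r ^ 2 / x ^ 2 = j at *
  have h0 := congrFun (congrArg WithLp.ofLp hT) 0
  have h1 := congrFun (congrArg WithLp.ofLp hT) 1
  have hR := F.R_eq
  have hr := F.r_sq
  have uu := F.uu
  have vv := F.vv
  have uv := F.uv
  have vw := F.vw
  have wu := F.wu
  have ou := F.ou
  have ov := F.ov
  have key : ((1 - j) * r + R) * r * inner ℝ (T - (I + (u + v + w - (2 : ℝ) • o))) (v - u) =
      R * r * (-(j * x * (x + y)) - z * (x - y)) + (1 - j) * r ^ 2 * (x + y) ^ 2 / 2 := by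
    simp only [plane_inner, PiLp.add_apply, PiLp.sub_apply, PiLp.smul_apply, smul_eq_mul] at *
    linear_combination r * (v 0 - u 0) * h0 + r * (v 1 - u 1) * h1
      + R * r * (j * (uv - uu) - (uv + vv + vw - 2 * ov - uu - uv - wu + 2 * ou))
      + (1 - j) * r ^ 2 * (ov - ou - uv + uu)
  rw [key]
  linear_combination (x + y + z) * (-(j * x * (x + y)) - z * (x - y)) * hR
    - (x + y) * (x + y) * (y + z) * (z + x) * hj
    + 2 * (x + y) ^ 2 * (1 - j) * (x + y + z) * hr - 2 * (x + y) ^ 2 * (y * z) * hj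

theorem IsMixtilinearData.swap {ω : EuclideanGeometry.Sphere Plane}
    {T : Plane} (h : IsMixtilinearData u v w o I x r R ω T) :
    IsMixtilinearData u w v o I x r R ω T := by
  have e : u + w + v = u + v + w := by abel
  refine ⟨h.r_lt, h.center_eq, h.radius_eq, ?_, ?_⟩
  · rw [e]; exact h.touch_eq
  · rw [add_comm w v]; exact h.dist_eq

/-- The point of tangency is on the circle with center `I + h + q` through the orthocenter. -/
theorem dist_touch_eq (F : IsCenteredFrame u v w o x y z r R) {ω : EuclideanGeometry.Sphere Plane}
    {T q : Plane} (h : IsMixtilinearData u v w o I x r R ω T)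
    (hq : (touchWeight x y z + touchWeight y z x + touchWeight z x y) • q =
      touchWeight x y z • (o - u) + touchWeight y z x • (o - v) + touchWeight z x y • (o - w)) :
    dist T (I + (u + v + w - (2 : ℝ) • o) + q) = ‖q‖ := by
  have e1 := F.touch_inner h
  have e2 := F.swap.touch_inner h.swap
  rw [show u + w + v = u + v + w by abel] at e2
  have hx := F.x_pos
  have hy := F.y_pos
  have hz := F.z_pos
  have hr := F.r_pos
  have hR := F.R_pos
  have hρ : 0 < ω.radius := by
    rw [h.radius_eq]
    refine mul_pos (sub_pos.2 ?_) hr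
    rw [div_lt_one (by positivity)]
    exact pow_lt_pow_left₀ h.r_lt hr.le two_ne_zero
  obtain ⟨t, ht⟩ : ∃ t, T = I + (u + v + w - (2 : ℝ) • o) + t :=
    ⟨T - (I + (u + v + w - (2 : ℝ) • o)), by abel⟩
  have hd := congrArg (· ^ 2) h.dist_eq
  rw [ht, add_sub_cancel_left] at e1 e2
  -- Since `T` and `H` lie on the circle with center `H + (o - u)`, we have `|t|² = 2 t·(o - u)`.
  -- The goal `|t|² = 2 t·q` thus amounts to `t ⊥ q - (o - u)`, which is this identity.
  have e3 : touchWeight y z x * inner ℝ t (v - u) + touchWeight z x y * inner ℝ t (w - u) = 0 := by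
    have hc : 4 * (x + y + z) ^ 2 * (ω.radius + R) * r ≠ 0 := by positivity
    apply mul_left_cancel₀ hc
    simp only [touchWeight]
    linear_combination (y * (z + x) * (y + z + 2 * x) * (y + 2 * z + x)) * e1
      + (z * (x + y) * (z + x + 2 * y) * (z + 2 * x + y)) * e2
  have w1 := touchWeight_pos hx hy hz
  have w2 := touchWeight_pos hy hz hx
  have w3 := touchWeight_pos hz hx hy
  rw [dist_eq_norm, ← sq_eq_sq₀ (norm_nonneg _) (norm_nonneg _), plane_norm_sq, plane_norm_sq]
  have hW : touchWeight x y z + touchWeight y z x + touchWeight z x y ≠ 0 := by positivity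
  have q0 := congrFun (congrArg WithLp.ofLp hq) 0
  have q1 := congrFun (congrArg WithLp.ofLp hq) 1
  have uu := F.uu
  have oo := F.oo
  have ou := F.ou
  rw [ht] at hd ⊢
  simp only [plane_dist_sq, plane_inner, PiLp.add_apply, PiLp.sub_apply, PiLp.smul_apply,
    smul_eq_mul] at *
  apply mul_left_cancel₀ hW
  linear_combination (touchWeight x y z + touchWeight y z x + touchWeight z x y) *
    (hd - oo + 2 * ou - uu) - 2 * t 0 * q0 - 2 * t 1 * q1 + 2 * e3

/-! ### Claim 2: a circle tangent to all three passes through `H`. -/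

/-- `|2I - O - H| = R - 2r`. -/
theorem inner_add_self (F : IsCenteredFrame u v w o x y z r R) :
    inner ℝ (o + (u + v + w - (2 : ℝ) • o)) (o + (u + v + w - (2 : ℝ) • o)) = (R - 2 * r) ^ 2 := by
  have hs : x + y + z ≠ 0 := (add_pos (add_pos F.x_pos F.y_pos) F.z_pos).ne'
  have h : x * y + y * z + z * x = r ^ 2 + 4 * (R * r) := by
    apply mul_right_cancel₀ hs
    linear_combination -F.r_sq - F.R_eq
  have uu := F.uu
  have vv := F.vv
  have ww := F.ww
  have uv := F.uv
  have vw := F.vw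
  have wu := F.wu
  have ou := F.ou
  have ov := F.ov
  have ow := F.ow
  have oo := F.oo
  simp only [plane_inner, PiLp.add_apply, PiLp.sub_apply, PiLp.smul_apply, smul_eq_mul] at *
  linear_combination uu + vv + ww + oo + 2 * uv + 2 * vw + 2 * wu - 2 * ou - 2 * ov - 2 * ow - 2 * h

/-- Euler's inequality. -/
theorem two_mul_r_le (F : IsCenteredFrame u v w o x y z r R) : 2 * r ≤ R := by
  have h := F.oo ▸ real_inner_self_nonneg (F := Plane) (x := o)
  have : 0 ≤ R * (R - 2 * r) := by linarith
  have := nonneg_of_mul_nonneg_right this F.R_pos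
  linarith

/-- The tangency of a circle with center `I + h + p` and radius `ρ` to `ω`, compared with the
tangency of the circle with center `2I - O` and radius `R - 2r`. -/
theorem tangency_eq (F : IsCenteredFrame u v w o x y z r R) {ω : EuclideanGeometry.Sphere Plane}
    {T p h δ : Plane} {ρ G k : ℝ} (hω : IsMixtilinearData u v w o I x r R ω T)
    (hd : dist (I + h + p) ω.center = ρ + ω.radius)
    (hh : h = u + v + w - (2 : ℝ) • o)
    (hG : G = r ^ 2 + x ^ 2 + y ^ 2 + z ^ 2 + 4 * (R * r) - 4 * R ^ 2)
    (hk : k = inner ℝ p p - ρ ^ 2)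
    (hδ : δ = G • (p + o + h) + k • o) :
    r ^ 2 * inner ℝ δ (u - h) +
      (x ^ 2 - r ^ 2) * ((G * (ρ - R + 2 * r) - k * (R - r / 2)) * r - inner ℝ δ h) = 0 := by
  have hj : r ^ 2 / x ^ 2 * x ^ 2 = r ^ 2 := div_mul_cancel₀ _ (pow_pos F.x_pos 2).ne'
  rw [hω.center_eq, hω.radius_eq] at hd
  generalize r ^ 2 / x ^ 2 = j at *
  have hd := congrArg (· ^ 2) hd
  have E1 := F.inner_add_self
  rw [← hh] at E1
  have uu := F.uu
  have ou := F.ou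
  have ov := F.ov
  have ow := F.ow
  have oo := F.oo
  have oh : inner ℝ o h = (G - 2 * (R * r) + 2 * r ^ 2) / 2 := by
    rw [hh, hG]
    simp only [plane_inner, PiLp.add_apply, PiLp.sub_apply, PiLp.smul_apply, smul_eq_mul] at *
    linear_combination ou + ov + ow - 2 * oo
  clear hh
  have key : j * inner ℝ δ (u - h) +
      (1 - j) * ((G * (ρ - R + 2 * r) - k * (R - r / 2)) * r - inner ℝ δ h) = 0 := by
    rw [hδ]
    simp only [plane_inner, plane_dist_sq, PiLp.add_apply, PiLp.sub_apply, PiLp.smul_apply,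
      smul_eq_mul] at *
    -- Seen from `H`, `ω` has center `ju - h` and radius `(1 - j)r`. `a1` and `a2` are the squared
    -- tangency conditions for the given circle and for the one with center `2I - O`. Their
    -- difference has constant term `k/2`, and `a3` serves to cancel it.
    have a1 : p 0 * (j * u 0 - h 0) + p 1 * (j * u 1 - h 1) + ρ * ((1 - j) * r) =
        (k + ((j * u 0 - h 0) ^ 2 + (j * u 1 - h 1) ^ 2) - ((1 - j) * r) ^ 2) / 2 := by
      linear_combination -hd / 2 - hk / 2
    have a2 : -(o 0 + h 0) * (j * u 0 - h 0) - (o 1 + h 1) * (j * u 1 - h 1) +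
        (R - 2 * r) * ((1 - j) * r) =
        ((j * u 0 - h 0) ^ 2 + (j * u 1 - h 1) ^ 2 - ((1 - j) * r) ^ 2) / 2 := by
      linear_combination E1 / 2 - (oo + 2 * j * ou + j ^ 2 * uu) / 2 - (1 + j) / 2 * hj
    have a3 : o 0 * (j * u 0 - h 0) + o 1 * (j * u 1 - h 1) - (R - r / 2) * ((1 - j) * r) =
        -G / 2 := by
      linear_combination j * ou - oh + hj / 2
    linear_combination G * (a1 - a2) + k * a3
  linear_combination x ^ 2 * key - (inner ℝ δ (u - h) -
    ((G * (ρ - R + 2 * r) - k * (R - r / 2)) * r - inner ℝ δ h)) * hj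

/-- The defining quantity of an acute triangle. -/
theorem acute_pos (F : IsCenteredFrame u v w o x y z r R) (hx : 0 < x * (x + y + z) - y * z)
    (hy : 0 < y * (x + y + z) - z * x) (hz : 0 < z * (x + y + z) - x * y) :
    0 < r ^ 2 + x ^ 2 + y ^ 2 + z ^ 2 + 4 * (R * r) - 4 * R ^ 2 := by
  have hr := F.r_pos
  have := F.x_pos
  have := F.y_pos
  have := F.z_pos
  have hs : 0 < x + y + z := by positivity
  have h : x * y + y * z + z * x = r ^ 2 + 4 * (R * r) := by
    apply mul_right_cancel₀ hs.ne'
    linear_combination -F.r_sq - F.R_eq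
  have h1 : 2 * (2 * (R * r) + r ^ 2) * (x + y + z) =
      (x + y) * (y + z) * (z + x) + 2 * (x * y * z) := by
    linear_combination F.R_eq + 2 * F.r_sq
  have h2 : 4 * (x + y + z) ^ 2 * r ^ 2 *
      (r ^ 2 + x ^ 2 + y ^ 2 + z ^ 2 + 4 * (R * r) - 4 * R ^ 2) =
      (x * (x + y + z) - y * z) * (y * (x + y + z) - z * x) * (z * (x + y + z) - x * y) := by
    -- Here `x + y + z` is the semiperimeter, so this is the acuteness criterion `s > 2R + r`.
    have h3 : r ^ 2 + x ^ 2 + y ^ 2 + z ^ 2 + 4 * (R * r) - 4 * R ^ 2 =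
        (x + y + z) ^ 2 - (2 * R + r) ^ 2 := by linear_combination -2 * h
    rw [h3]
    linear_combination 4 * (x + y + z) ^ 3 * F.r_sq - (2 * (2 * (R * r) + r ^ 2) * (x + y + z) +
      ((x + y) * (y + z) * (z + x) + 2 * (x * y * z))) * h1
  have h3 : 0 < 4 * (x + y + z) ^ 2 * r ^ 2 := by positivity
  have h4 := mul_pos (mul_pos hx hy) hz
  rw [← h2] at h4
  exact pos_of_mul_pos_right h4 h3.le

/-- A circle of positive radius `ρ` and center `I + h + p` externally tangent to the three circles
passes through the orthocenter. -/
theorem norm_eq_of_tangent (F : IsCenteredFrame u v w o x y z r R)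
    {ωA ωB ωC : EuclideanGeometry.Sphere Plane} {A' B' C' p h : Plane} {ρ : ℝ}
    (hA : IsMixtilinearData u v w o I x r R ωA A')
    (hB : IsMixtilinearData v w u o I y r R ωB B')
    (hC : IsMixtilinearData w u v o I z r R ωC C')
    (hh : h = u + v + w - (2 : ℝ) • o) (hρ : 0 < ρ)
    (dA : dist (I + h + p) ωA.center = ρ + ωA.radius)
    (dB : dist (I + h + p) ωB.center = ρ + ωB.radius)
    (dC : dist (I + h + p) ωC.center = ρ + ωC.radius) : ‖p‖ = ρ := by
  have aA := hA.acute F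
  have aB := hB.acute F.rotate
  have aC := hC.acute F.rotate.rotate
  rw [show y + z + x = x + y + z by ring] at aB
  rw [show z + x + y = x + y + z by ring] at aC
  have hGpos := F.acute_pos aA aB aC
  have hx := F.x_pos
  have hr := F.r_pos
  have hxr := pow_lt_pow_left₀ hA.r_lt hr.le two_ne_zero
  have hyr := pow_lt_pow_left₀ hB.r_lt hr.le two_ne_zero
  have hzr := pow_lt_pow_left₀ hC.r_lt hr.le two_ne_zero
  obtain ⟨G, hG⟩ : ∃ G, G = r ^ 2 + x ^ 2 + y ^ 2 + z ^ 2 + 4 * (R * r) - 4 * R ^ 2 := ⟨_, rfl⟩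
  obtain ⟨k, hk⟩ : ∃ k, k = inner ℝ p p - ρ ^ 2 := ⟨_, rfl⟩
  obtain ⟨δ, hδ⟩ : ∃ δ, δ = G • (p + o + h) + k • o := ⟨_, rfl⟩
  rw [← hG] at hGpos
  have tA := F.tangency_eq hA dA hh hG hk hδ
  have tB := F.rotate.tangency_eq hB dB (by rw [hh]; abel) (by rw [hG]; ring) hk hδ
  have tC := F.rotate.rotate.tangency_eq hC dC (by rw [hh]; abel) (by rw [hG]; ring) hk hδ
  obtain ⟨Φ, hΦ⟩ : ∃ Φ, Φ = (G * (ρ - R + 2 * r) - k * (R - r / 2)) * r - inner ℝ δ h := ⟨_, rfl⟩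
  rw [← hΦ] at tA tB tC
  have hO := F.orthocenter_eq
  rw [← hh] at hO
  have h0 := congrFun (congrArg WithLp.ofLp hO) 0
  have h1 := congrFun (congrArg WithLp.ofLp hO) 1
  obtain ⟨α, hα⟩ : ∃ α, α = x * (x + y + z) - y * z := ⟨_, rfl⟩
  obtain ⟨β, hβ⟩ : ∃ β, β = y * (x + y + z) - z * x := ⟨_, rfl⟩
  obtain ⟨γ, hγ⟩ : ∃ γ, γ = z * (x + y + z) - x * y := ⟨_, rfl⟩
  have hsum : β * γ + γ * α + α * β = 4 * (x * y * z) * (x + y + z) := by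
    rw [hα, hβ, hγ]; ring
  rw [← hα, ← hβ, ← hγ, ← hsum] at h0 h1
  rw [← hα] at aA
  rw [← hβ] at aB
  rw [← hγ] at aC
  -- `βγ`, `γα`, `αβ` are barycentric weights of `H`, positive for an acute triangle. Averaging the
  -- three tangency equations with them removes `δ` and leaves a positive multiple of `Φ`.
  have hf : β * γ * inner ℝ δ (u - h) + γ * α * inner ℝ δ (v - h) + α * β * inner ℝ δ (w - h) = 0 := by
    simp only [plane_inner, PiLp.add_apply, PiLp.sub_apply, PiLp.smul_apply, smul_eq_mul] at *
    linear_combination -δ 0 * h0 - δ 1 * h1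
  have hΦ0 : Φ = 0 := by
    have hpos : 0 < β * γ * (x ^ 2 - r ^ 2) + γ * α * (y ^ 2 - r ^ 2) + α * β * (z ^ 2 - r ^ 2) := by
      have := sub_pos.2 hxr
      have := sub_pos.2 hyr
      have := sub_pos.2 hzr
      positivity
    apply mul_left_cancel₀ hpos.ne'
    linear_combination β * γ * tA + γ * α * tB + α * β * tC - r ^ 2 * hf
  rw [hΦ0] at tA tB tC
  simp only [mul_zero, add_zero, mul_eq_zero, (pow_pos hr 2).ne', false_or] at tA tB tC
  have hδ0 : δ = 0 := by
    apply F.eq_zero_of_inner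
    · rw [← sub_sub_sub_cancel_right v u h, inner_sub_right, tA, tB, sub_zero]
    · rw [← sub_sub_sub_cancel_right w u h, inner_sub_right, tA, tC, sub_zero]
  have hrad : G * ρ = G * (R - 2 * r) + k * (R - r / 2) := by
    rw [hδ0, inner_zero_left, hΦ0, sub_zero] at hΦ
    apply mul_right_cancel₀ hr.ne'
    linear_combination -hΦ
  have hcen : G • p = -(G • (o + h)) - k • o := by
    rw [hδ0] at hδ
    rw [eq_comm, ← sub_eq_zero, ← neg_eq_zero, hδ]
    simp only [smul_add]
    abel
  have hRr := F.two_mul_r_le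
  have n1 : ‖o + h‖ = R - 2 * r := by
    rw [← sq_eq_sq₀ (norm_nonneg _) (by linarith), ← real_inner_self_eq_norm_sq, hh,
      F.inner_add_self]
  have n2 : ‖o‖ < R - r / 2 := by
    apply lt_of_pow_lt_pow_left₀ 2 (by linarith)
    rw [← real_inner_self_eq_norm_sq, F.oo]
    have := F.R_pos
    nlinarith [mul_pos this hr, pow_pos hr 2]
  rw [real_inner_self_eq_norm_sq] at hk
  -- `k` is the power of `H`. By `hcen` and `hrad`, center and radius change with `k` at rates
  -- proportional to `‖o‖` and `R - r/2`. As `‖o‖ < R - r/2`, the triangle inequality contradicts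
  -- `‖p‖ < ρ` if `k < 0` and `‖p‖ > ρ` if `k > 0`.
  rcases lt_trichotomy k 0 with hk0 | hk0 | hk0
  · exfalso
    have hlt : ‖p‖ < ρ := lt_of_pow_lt_pow_left₀ 2 hρ.le (by linarith)
    have e : G • (o + h) = -(G • p) - k • o := by rw [hcen]; abel
    have := norm_sub_le (-(G • p)) (k • o)
    rw [← e, norm_neg, norm_smul, norm_smul, norm_smul, Real.norm_of_nonneg hGpos.le, n1,
      Real.norm_of_nonpos hk0.le] at this
    linarith [mul_lt_mul_of_pos_left hlt hGpos, mul_lt_mul_of_pos_left n2 (neg_pos.2 hk0)]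
  · rw [← sq_eq_sq₀ (norm_nonneg _) hρ.le]
    linarith
  · exfalso
    have hlt : ρ < ‖p‖ := lt_of_pow_lt_pow_left₀ 2 (norm_nonneg _) (by linarith)
    have := norm_sub_le (-(G • (o + h))) (k • o)
    rw [← hcen, norm_neg, norm_smul, norm_smul, norm_smul, Real.norm_of_nonneg hGpos.le, n1,
      Real.norm_of_nonneg hk0.le] at this
    linarith [mul_lt_mul_of_pos_left hlt hGpos, mul_lt_mul_of_pos_left n2 hk0]

end IsCenteredFrame

/-! ### Exclusion of right angles and assembly. -/

theorem mainTheorem10 (A B C : Plane) (hABC : AffineIndependent ℝ ![A, B, C])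
    (H : Plane) (hH : H = Affine.Triangle.orthocenter (⟨![A, B, C], hABC⟩ : Affine.Triangle ℝ Plane))
    (ωA ωB ωC : EuclideanGeometry.Sphere Plane) (A' B' C' : Plane)
    (hA : IsSideTangentCircleAt ωA A' A B C H)
    (hB : IsSideTangentCircleAt ωB B' B C A H)
    (hC : IsSideTangentCircleAt ωC C' C A B H) :
    (∃ Γ : EuclideanGeometry.Sphere Plane,
      0 < Γ.radius ∧ A' ∈ Γ ∧ B' ∈ Γ ∧ C' ∈ Γ ∧ H ∈ Γ) ∧
    (∀ Ω : EuclideanGeometry.Sphere Plane, 0 < Ω.radius →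
      Ω.IsExtTangent ωA → Ω.IsExtTangent ωB → Ω.IsExtTangent ωC → H ∈ Ω) := by
  obtain ⟨I, u, v, w, o, x, y, z, r, R, F, rfl, rfl, rfl, hH'⟩ :=
    exists_isCenteredFrame A B C hABC H hH
  clear hH
  obtain ⟨h, hh⟩ : ∃ h, h = u + v + w - (2 : ℝ) • o := ⟨_, rfl⟩
  have hh₁ : h = v + w + u - (2 : ℝ) • o := by rw [hh]; abel
  have hh₂ : h = w + u + v - (2 : ℝ) • o := by rw [hh]; abel
  rw [← hh] at hH'
  subst hH'
  have F₁ := F.rotate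
  have F₂ := F₁.rotate
  have hx := F.x_pos
  have hy := F.y_pos
  have hz := F.z_pos
  have mA (hβ : y * (x + y + z) - z * x ≠ 0) (hγ : z * (x + y + z) - x * y ≠ 0) :
      IsCenteredFrame.IsMixtilinearData u v w o I x r R ωA A' :=
    F.isMixtilinearData hβ hγ (hh ▸ hA)
  have mB (hγ : z * (x + y + z) - x * y ≠ 0) (hα : x * (x + y + z) - y * z ≠ 0) :
      IsCenteredFrame.IsMixtilinearData v w u o I y r R ωB B' :=
    F₁.isMixtilinearData (by convert hγ using 2; ring) (by convert hα using 2; ring) (hh₁ ▸ hB)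
  have mC (hα : x * (x + y + z) - y * z ≠ 0) (hβ : y * (x + y + z) - z * x ≠ 0) :
      IsCenteredFrame.IsMixtilinearData w u v o I z r R ωC C' :=
    F₂.isMixtilinearData (by convert hα using 2; ring) (by convert hβ using 2; ring) (hh₂ ▸ hC)
  -- A right angle at one vertex rules out right angles at the others, so the circle at that vertex
  -- is still determined, and its existence would make the angle acute.
  have hα : x * (x + y + z) - y * z ≠ 0 := by
    intro hα
    have hβ : y * (x + y + z) - z * x ≠ 0 := by nlinarith [mul_pos hx hy]
    have hγ : z * (x + y + z) - x * y ≠ 0 := by nlinarith [mul_pos hx hz]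
    exact ((mA hβ hγ).acute F).ne' hα
  have hβ : y * (x + y + z) - z * x ≠ 0 := by
    intro hβ
    have hγ : z * (x + y + z) - x * y ≠ 0 := by nlinarith [mul_pos hy hz]
    exact ((mB hγ hα).acute F₁).ne' (by linear_combination hβ)
  have hγ : z * (x + y + z) - x * y ≠ 0 := by
    intro hγ
    exact ((mC hα hβ).acute F₂).ne' (by linear_combination hγ)
  replace mA := mA hβ hγ
  replace mB := mB hγ hα
  replace mC := mC hα hβ
  constructor
  · have w1 := touchWeight_pos hx hy hz
    have w2 := touchWeight_pos hy hz hx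
    have w3 := touchWeight_pos hz hx hy
    obtain ⟨q, hq⟩ : ∃ q, (touchWeight x y z + touchWeight y z x + touchWeight z x y) • q =
        touchWeight x y z • (o - u) + touchWeight y z x • (o - v) + touchWeight z x y • (o - w) :=
      ⟨(touchWeight x y z + touchWeight y z x + touchWeight z x y)⁻¹ • _,
        smul_inv_smul₀ (by positivity) _⟩
    have dA := F.dist_touch_eq mA hq
    have dB := F₁.dist_touch_eq (q := q) mB (by
      rw [show touchWeight y z x + touchWeight z x y + touchWeight x y z =
        touchWeight x y z + touchWeight y z x + touchWeight z x y by ring, hq]; abel)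
    have dC := F₂.dist_touch_eq (q := q) mC (by
      rw [show touchWeight z x y + touchWeight x y z + touchWeight y z x =
        touchWeight x y z + touchWeight y z x + touchWeight z x y by ring, hq]; abel)
    rw [← hh] at dA
    rw [← hh₁] at dB
    rw [← hh₂] at dC
    -- If `q = 0`, as for an equilateral triangle, all three touch points equal `H`, and any circle
    -- of positive radius through `H` serves.
    by_cases hq0 : q = 0
    · subst hq0
      simp only [add_zero, norm_zero, dist_eq_zero] at dA dB dC
      obtain ⟨e, he⟩ := exists_norm_eq Plane zero_le_one
      have hmem : I + h ∈ (⟨I + h + e, 1⟩ : EuclideanGeometry.Sphere Plane) := by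
        rw [EuclideanGeometry.mem_sphere, dist_self_add_right, he]
      exact ⟨⟨I + h + e, 1⟩, one_pos, dA ▸ hmem, dB ▸ hmem, dC ▸ hmem, hmem⟩
    · exact ⟨⟨I + h + q, ‖q‖⟩, norm_pos_iff.2 hq0, dA, dB, dC, dist_self_add_right _ _⟩
  · intro Ω hΩ tA tB tC
    have hc : Ω.center = I + h + (Ω.center - (I + h)) := by abel
    have := F.norm_eq_of_tangent mA mB mC hh hΩ (hc ▸ tA.dist_center) (hc ▸ tB.dist_center)
      (hc ▸ tC.dist_center)
    rw [EuclideanGeometry.mem_sphere, dist_comm, dist_eq_norm, this]
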